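/- Let $X$ be a compact connected Riemann surface with holomorphic cotangent bundle $K_X$, and let $D\subset X$ be a finite subset. A parabolic bundle $E_*$ is a holomorphic vector bundle $E$ on $X$ with, at each $p\in D$, a strictly decreasing flag $E_p=E_p^1\supsetneq\cdots\supsetneq E_p^{n_p}\supsetneq E_p^{n_p+1}=0$ and weights $0\le\alpha_{p,1}<\cdots<\alpha_{p,n_p}<1$. For $t=m+\tau$ with $m\in\mathbb Z$, $0\le\tau<1$, let $E_t$ be the sheaf of sections of $E(-mD)$ whose leading coefficient at each $p\in D$ lies in the largest $E_p^j$ with $\alpha_{p,j}\ge\tau$ (in $0$ if there is none). All these sheaves, and those below, are subsheaves of the direct image of sheaves of sections over $X\setminus D$. A homomorphism of parabolic bundles is a homomorphism over $X\setminus D$ that maps the $t$-th sheaf into the $t$-th sheaf for every $t\in\mathbb R$; an isomorphism is one with an inverse homomorphism. The parabolic tensor product is given by $(E_*\otimes F_*)_t=\sum_{a+b\ge t}E_a\otimes F_b$; the parabolic dual by letting $(E_*^*)_t$ be the sheaf of functionals that carry $E_a$ into $\mathcal O_X(-\lceil a+t\rceil D)$ for all $a$; $\mathrm{Sym}^2(E_*)$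 and $\bigwedge^2E_*$ are the symmetric and antisymmetric tensors in $E_*\otimes E_*$. The line bundle $K_X(D)$ has the trivial parabolic structure (weight $0$), and $H^0(X,V_*)$ denotes the global sections of $V_0$. Let $E_*$ be a parabolic bundle and $L_*$ a parabolic line bundle. A homomorphism $\phi:E_*\otimes E_*\to L_*$ is a parabolic symplectic (respectively, orthogonal) structure if it is antisymmetric (respectively, symmetric) over $X\setminus D$ and the adjoint map $\widehat\phi:E_*\to E_*^*\otimes L_*$, $u\mapsto\phi(u\otimes\,\cdot\,)$, is an isomorphism of parabolic bundles. A parabolic Higgs field is a section $\theta\in H^0(X,\mathrm{ad}_P(E)\otimes K_X(D))$, where $\mathrm{ad}_P(E)$ is the sheaf of trace-free holomorphic endomorphisms of $E$ that preserve the flags over $D$. It is compatible with $\phi$ if $$(\phi\otimes\mathrm{Id}_{K_X(D)})(\theta(u)\otimes v)+(\phi\otimes\mathrm{Id}_{K_X(D)})(u\otimes\theta(v))=0$$ for all local holomorphic sections $u,v$ of $E$. Let $\widetilde\theta$ be the image of $\theta$ under the isomorphism $$\mathrm{End}(E_*)\cong E_*\otimes E_*^*\otimes L_*\otimes L_*^*\xrightarrow{\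 \mathrm{Id}\otimes\widehat\phi^{-1}\otimes\mathrm{Id}\ }E_*\otimes E_*\otimes L_*^*$$ tensored with $K_X(D)$. Let $\theta$ be a parabolic Higgs field on $E_*$. (1) A parabolic symplectic structure $\phi:E_*\otimes E_*\to L_*$ is compatible with $\theta$ if and only if $\widetilde\theta\in H^0\big(X,\mathrm{Sym}^2(E_*)\otimes L_*^*\otimes K_X(D)\big)$. (2) A parabolic orthogonal structure $\phi:E_*\otimes E_*\to L_*$ is compatible with $\theta$ if and only if $\widetilde\theta\in H^0\big(X,\big(\bigwedge^2E_*\big)\otimes L_*^*\otimes K_X(D)\big)$. -/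

import Mathlib

open Bundle TopologicalSpace
open scoped Manifold ContDiff Topology TensorProduct

noncomputable section

namespace ParabolicHiggs

/-! ### Linear algebra in one fibre -/

section LinearAlgebra

variable {V L K : Type*} [AddCommGroup V] [Module ℂ V] [AddCommGroup L] [Module ℂ L]
  [AddCommGroup K] [Module ℂ K]

/-- The map `V → V^* ⊗ L` adjoint to a pairing `φ : V ⊗ V → L`: it sends `u` to the element of
`V^* ⊗ L = Hom(V, L)` given by `v ↦ φ (u ⊗ v)`. -/
def hat [FiniteDimensional ℂ V] (φ : V ⊗[ℂ] V →ₗ[ℂ] L) : V →ₗ[ℂ] Module.Dual ℂ V ⊗[ℂ] L :=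
  (dualTensorHomEquiv ℂ V L).symm.toLinearMap ∘ₗ TensorProduct.curry φ

theorem contractRight_bijective (hL : Module.finrank ℂ L = 1) :
    Function.Bijective (contractRight ℂ L) := by
  have : FiniteDimensional ℂ L := Module.finite_of_finrank_eq_succ hL
  have : Nontrivial L := Module.nontrivial_of_finrank_pos (R := ℂ) (by omega)
  have hs : Function.Surjective (contractRight ℂ L) := by
    obtain ⟨v, hv⟩ := exists_ne (0 : L)
    obtain ⟨f, hfv⟩ : ∃ f : Module.Dual ℂ L, f v ≠ 0 := by
      by_contra! h
      exact hv ((Module.forall_dual_apply_eq_zero_iff ℂ v).1 h)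
    intro c
    exact ⟨(c / f v) • (v ⊗ₜ f), by simp [contractRight_apply, hfv]⟩
  exact ⟨(LinearMap.injective_iff_surjective_of_finrank_eq_finrank
    (by simp [Module.finrank_tensorProduct, Subspace.dual_finrank_eq, hL])).2 hs, hs⟩

/-- The canonical isomorphism `L ⊗ L^* ≅ ℂ` for a line `L`. -/
def lineContract (hL : Module.finrank ℂ L = 1) : L ⊗[ℂ] Module.Dual ℂ L ≃ₗ[ℂ] ℂ :=
  LinearEquiv.ofBijective (contractRight ℂ L) (contractRight_bijective hL)

/-- The isomorphism
`End V ≅ V ⊗ V^* ≅ V ⊗ (V^* ⊗ L) ⊗ L^* ≅ V ⊗ V ⊗ L^*`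
induced by an isomorphism `e : V ≅ V^* ⊗ L`; the last step is `id ⊗ e⁻¹ ⊗ id`. -/
def endEquiv [FiniteDimensional ℂ V] (hL : Module.finrank ℂ L = 1)
    (e : V ≃ₗ[ℂ] Module.Dual ℂ V ⊗[ℂ] L) :
    Module.End ℂ V ≃ₗ[ℂ] (V ⊗[ℂ] V) ⊗[ℂ] Module.Dual ℂ L :=
  -- `End V ≅ V^* ⊗ V`
  (dualTensorHomEquiv ℂ V V).symm ≪≫ₗ
  -- `≅ V ⊗ V^*`
  TensorProduct.comm ℂ (Module.Dual ℂ V) V ≪≫ₗ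
  -- `≅ (V ⊗ V^*) ⊗ ℂ`
  (TensorProduct.rid ℂ (V ⊗[ℂ] Module.Dual ℂ V)).symm ≪≫ₗ
  -- `≅ (V ⊗ V^*) ⊗ (L ⊗ L^*)`
  TensorProduct.congr (LinearEquiv.refl ℂ (V ⊗[ℂ] Module.Dual ℂ V)) (lineContract hL).symm ≪≫ₗ
  -- `≅ ((V ⊗ V^*) ⊗ L) ⊗ L^*`
  (TensorProduct.assoc ℂ (V ⊗[ℂ] Module.Dual ℂ V) L (Module.Dual ℂ L)).symm ≪≫ₗ
  -- `≅ (V ⊗ (V^* ⊗ L)) ⊗ L^*`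
  TensorProduct.congr (TensorProduct.assoc ℂ V (Module.Dual ℂ V) L)
    (LinearEquiv.refl ℂ (Module.Dual ℂ L)) ≪≫ₗ
  -- `≅ (V ⊗ V) ⊗ L^*`
  TensorProduct.congr (TensorProduct.congr (LinearEquiv.refl ℂ V) e.symm)
    (LinearEquiv.refl ℂ (Module.Dual ℂ L))

/-- For `θ ∈ End V ⊗ K` and `u ∈ V`, the vector `θ(u) ∈ V ⊗ K`. -/
def higgsApply (θ : Module.End ℂ V ⊗[ℂ] K) (u : V) : V ⊗[ℂ] K :=
  LinearMap.rTensor K (LinearMap.applyₗ u) θ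

/-- `(φ ⊗ id_K)(w ⊗ v) ∈ L ⊗ K` for `w ∈ V ⊗ K` and `v ∈ V`. -/
def pairLeft (φ : V ⊗[ℂ] V →ₗ[ℂ] L) (w : V ⊗[ℂ] K) (v : V) : L ⊗[ℂ] K :=
  LinearMap.rTensor K ((TensorProduct.curry φ).flip v) w

/-- `(φ ⊗ id_K)(u ⊗ w) ∈ L ⊗ K` for `u ∈ V` and `w ∈ V ⊗ K`. -/
def pairRight (φ : V ⊗[ℂ] V →ₗ[ℂ] L) (u : V) (w : V ⊗[ℂ] K) : L ⊗[ℂ] K :=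
  LinearMap.rTensor K (TensorProduct.curry φ u) w

end LinearAlgebra

/-! ### Filtered sheaves on a Riemann surface with marked points -/

variable {X : Type*} [TopologicalSpace X]

/-- The complement `X ∖ D` of the set of marked points. -/
abbrev Cpl (D : Finset X) : Type _ := {x : X // x ∉ D}

/-- A real-indexed family of subsheaves `V_t` (`t ∈ ℝ`) of `j_* V`, for a family `V` of vector
spaces over `X ∖ D` and the inclusion `j : X ∖ D → X`: the set `P t U` consists of those `s` whose
restriction to `U ∖ D` is a section of `V_t` over `U`.  All instances used below are explicit
constructions, in which membership depends only on `s` restricted to `U ∖ D`. -/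
abbrev Filtered (D : Finset X) (V : Cpl D → Type*) : Type _ :=
  ℝ → Opens X → Set (∀ x : Cpl D, V x)

section Operations

variable {D : Finset X} {V W : Cpl D → Type*}
  [∀ x, AddCommGroup (V x)] [∀ x, Module ℂ (V x)]
  [∀ x, AddCommGroup (W x)] [∀ x, Module ℂ (W x)]

/-- The parabolic tensor product: `(V ⊗ W)_t` is the subsheaf of `j_*(V ⊗ W)` generated by all
`V_a ⊗ W_b` with `a + b ≥ t`. -/
def tensor (P : Filtered D V) (Q : Filtered D W) :
    Filtered D (fun x => V x ⊗[ℂ] W x) :=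
  fun t U => {σ | ∀ y ∈ U, ∃ N : Opens X, y ∈ N ∧ N ≤ U ∧
    ∃ (n : ℕ) (a b : Fin n → ℝ) (e : Fin n → ∀ x, V x) (f : Fin n → ∀ x, W x),
      (∀ k, t ≤ a k + b k ∧ e k ∈ P (a k) N ∧ f k ∈ Q (b k) N) ∧
      ∀ x : Cpl D, x.1 ∈ N → σ x = ∑ k, e k x ⊗ₜ[ℂ] f k x}

/-- The parabolic symmetric square, the subsheaf of symmetric tensors in the parabolic tensor
square. -/
def sym2 (P : Filtered D V) : Filtered D (fun x => V x ⊗[ℂ] V x) :=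
  fun t U => {σ | σ ∈ tensor P P t U ∧
    ∀ x : Cpl D, x.1 ∈ U → TensorProduct.comm ℂ (V x) (V x) (σ x) = σ x}

/-- The parabolic exterior square, the subsheaf of antisymmetric tensors in the parabolic tensor
square. -/
def wedge2 (P : Filtered D V) : Filtered D (fun x => V x ⊗[ℂ] V x) :=
  fun t U => {σ | σ ∈ tensor P P t U ∧
    ∀ x : Cpl D, x.1 ∈ U → TensorProduct.comm ℂ (V x) (V x) (σ x) = -σ x}

/-- A homomorphism of filtered sheaves: a family of linear maps over `X ∖ D` that carries `V_t`
into `W_t` for every `t`. -/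
def IsHom (P : Filtered D V) (Q : Filtered D W) (f : ∀ x, V x →ₗ[ℂ] W x) : Prop :=
  ∀ (t : ℝ) (U : Opens X) (s : ∀ x, V x), s ∈ P t U → (fun x => f x (s x)) ∈ Q t U

/-- An isomorphism of filtered sheaves: a homomorphism with an inverse homomorphism. -/
def IsIso (P : Filtered D V) (Q : Filtered D W) (f : ∀ x, V x →ₗ[ℂ] W x) : Prop :=
  IsHom P Q f ∧ ∃ g : ∀ x, W x →ₗ[ℂ] V x, IsHom Q P g ∧
    (∀ x, g x ∘ₗ f x = LinearMap.id) ∧ ∀ x, f x ∘ₗ g x = LinearMap.id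

theorem IsIso.bijective {P : Filtered D V} {Q : Filtered D W} {f : ∀ x, V x →ₗ[ℂ] W x}
    (h : IsIso P Q f) (x : Cpl D) : Function.Bijective (f x) := by
  obtain ⟨_, g, _, h1, h2⟩ := h
  exact Function.bijective_iff_has_inverse.2
    ⟨g x, fun v => LinearMap.congr_fun (h1 x) v, fun w => LinearMap.congr_fun (h2 x) w⟩

end Operations

/-! ### Parabolic bundles -/

section Bundles

variable [ChartedSpace ℂ X]

section OneBundle

variable (F : Type*) [NormedAddCommGroup F] [NormedSpace ℂ F]
  {E : X → Type*} [TopologicalSpace (TotalSpace F E)]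
  [∀ x, TopologicalSpace (E x)] [FiberBundle F E]

/-- The section `g` of the holomorphic bundle `E` is holomorphic on a neighbourhood of `y`. -/
def HolAt (g : ∀ x, E x) (y : X) : Prop :=
  ContMDiffAt 𝓘(ℂ, ℂ) (𝓘(ℂ, ℂ).prod 𝓘(ℂ, F)) ω (fun x => TotalSpace.mk' F x (g x)) y

variable [∀ x, AddCommGroup (E x)] [∀ x, Module ℂ (E x)] {D : Finset X}

/-- Near `y` and off `D`, the section `s` has the form `z ^ m • g`, where `z` is a local coordinate
centred at `y`, and `g` is a holomorphic section of `E` near `y` whose value at `y` lies in `S`. -/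
def GermAt (y : X) (m : ℤ) (S : Submodule ℂ (E y)) (s : ∀ x : Cpl D, E x.1) : Prop :=
  ∃ g : ∀ x, E x, HolAt F g y ∧ g y ∈ S ∧
    ∀ᶠ x in 𝓝 y, ∀ h : x ∉ D, s ⟨x, h⟩ = (chartAt ℂ y x - chartAt ℂ y y) ^ m • g x

variable (D) in
/-- The holomorphic bundle `E(kD) = E ⊗ 𝒪(kD)` with the trivial parabolic structure (weight `0`):
its `t`-th sheaf is `E((k - ⌈t⌉)D)`. -/
def twisted (E : X → Type*) [TopologicalSpace (TotalSpace F E)] [∀ x, TopologicalSpace (E x)]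
    [FiberBundle F E] [∀ x, AddCommGroup (E x)] [∀ x, Module ℂ (E x)] (k : ℤ) :
    Filtered D (fun x => E x.1) :=
  fun t U => {s | ∀ y ∈ U,
    (y ∉ D → GermAt F y 0 ⊤ s) ∧ (y ∈ D → GermAt F y (⌈t⌉ - k) ⊤ s)}

end OneBundle

/-- A parabolic structure on `E` over `D`: at every `p ∈ D` a strictly decreasing flag
`E_p = E¹ ⊋ E² ⊋ ⋯ ⊋ Eⁿ ⊋ Eⁿ⁺¹ = 0` and weights `0 ≤ α₁ < ⋯ < αₙ < 1` (indices here start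
at `0`). -/
structure ParabolicStructure (D : Finset X) (E : X → Type*) [∀ x, AddCommGroup (E x)]
    [∀ x, Module ℂ (E x)] where
  len : D → ℕ
  flag : ∀ p : D, Fin (len p + 1) → Submodule ℂ (E p.1)
  flag_strictAnti : ∀ p, StrictAnti (flag p)
  flag_zero : ∀ p, flag p 0 = ⊤
  flag_last : ∀ p, flag p (Fin.last (len p)) = ⊥
  weight : ∀ p : D, Fin (len p) → ℝ
  weight_strictMono : ∀ p, StrictMono (weight p)
  weight_nonneg : ∀ p j, 0 ≤ weight p j
  weight_lt_one : ∀ p j, weight p j < 1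

namespace ParabolicStructure

variable {D : Finset X} {E : X → Type*} [∀ x, AddCommGroup (E x)] [∀ x, Module ℂ (E x)]

/-- The largest member of the flag at `p` whose weight is at least `τ` (zero if there is none). -/
def flagAt (P : ParabolicStructure D E) (p : D) (τ : ℝ) : Submodule ℂ (E p.1) :=
  ⨆ (j : Fin (P.len p)) (_ : τ ≤ P.weight p j), P.flag p j.castSucc

variable (F : Type*) [NormedAddCommGroup F] [NormedSpace ℂ F]
  [TopologicalSpace (TotalSpace F E)] [∀ x, TopologicalSpace (E x)] [FiberBundle F E]

/-- The filtered sheaf of a parabolic bundle: for `t = m + τ` with `m ∈ ℤ` and `0 ≤ τ < 1`, the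
sections of `E_t` are the sections of `E(-mD)` whose leading coefficient at every point `p` of `D`
lies in the part of the flag at `p` of weight at least `τ`. -/
def filtered (P : ParabolicStructure D E) : Filtered D (fun x => E x.1) :=
  fun t U => {s | ∀ y ∈ U, (y ∉ D → GermAt F y 0 ⊤ s) ∧
    ∀ h : y ∈ D, GermAt F y ⌊t⌋ (P.flagAt ⟨y, h⟩ (Int.fract t)) s}

/-- Sections over `U` of the sheaf of trace-free holomorphic endomorphisms of `E` that preserve
the flags. -/
def IsAdP (P : ParabolicStructure D E) (U : Opens X) (A : ∀ x, Module.End ℂ (E x)) : Prop :=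
  (∀ y ∈ U, ∀ g : ∀ x, E x, HolAt F g y → HolAt F (fun x => A x (g x)) y) ∧
  (∀ y ∈ U, LinearMap.trace ℂ (E y) (A y) = 0) ∧
  ∀ p : D, p.1 ∈ U → ∀ j, ∀ v ∈ P.flag p j, A p.1 v ∈ P.flag p j

end ParabolicStructure

/-- The trivial bundle `𝒪_X` with the trivial parabolic structure. -/
def structureSheaf (D : Finset X) : Filtered D (fun _ => ℂ) :=
  twisted (E := Bundle.Trivial X ℂ) ℂ D 0

/-- The parabolic dual: `(V^*)_t` consists of the functionals carrying `V_a` into `𝒪_{a+t}` for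
every `a`. -/
def dual {D : Finset X} {V : Cpl D → Type*} [∀ x, AddCommGroup (V x)] [∀ x, Module ℂ (V x)]
    (P : Filtered D V) : Filtered D (fun x => Module.Dual ℂ (V x)) :=
  fun t U => {σ | ∀ N : Opens X, N ≤ U → ∀ (a : ℝ) (e : ∀ x, V x), e ∈ P a N →
    (fun x => σ x (e x)) ∈ structureSheaf D (a + t) N}

variable [IsManifold 𝓘(ℂ, ℂ) ω X]

/-- The fibre at `x` of the holomorphic cotangent bundle `K_X`. -/
abbrev Cotangent (x : X) : Type :=
  TangentSpace 𝓘(ℂ, ℂ) x →L[ℂ] Bundle.Trivial X ℂ x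

variable (X) in
/-- The line bundle `K_X(D)` with the trivial parabolic structure; its sections are the meromorphic
`1`-forms with at most simple poles on `D`. -/
def canonicalLog (D : Finset X) : Filtered D (fun x => Cotangent (X := X) x.1) :=
  twisted (E := fun x : X => Cotangent x) (ℂ →L[ℂ] ℂ) D 1

section Main

variable {D : Finset X}
  (FE : Type*) [NormedAddCommGroup FE] [NormedSpace ℂ FE]
  {E : X → Type*} [∀ x, AddCommGroup (E x)] [∀ x, Module ℂ (E x)]
  [TopologicalSpace (TotalSpace FE E)] [∀ x, TopologicalSpace (E x)] [FiberBundle FE E]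

/-- A parabolic Higgs field on `E_*`: a global section of `ad_P(E) ⊗ K_X(D)`, given by its
restriction to `X ∖ D`. -/
def IsHiggsField (P : ParabolicStructure D E)
    (θ : ∀ x : Cpl D, Module.End ℂ (E x.1) ⊗[ℂ] Cotangent x.1) : Prop :=
  ∀ y : X, ∃ N : Opens X, y ∈ N ∧
    ∃ (n : ℕ) (A : Fin n → ∀ x, Module.End ℂ (E x)) (η : Fin n → ∀ x : Cpl D, Cotangent x.1),
      (∀ k, P.IsAdP FE N (A k) ∧ η k ∈ canonicalLog X D 0 N) ∧
      ∀ x : Cpl D, x.1 ∈ N → θ x = ∑ k, A k x.1 ⊗ₜ[ℂ] η k x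

variable {L : X → Type*} [∀ x, AddCommGroup (L x)] [∀ x, Module ℂ (L x)]

/-- Compatibility of a Higgs field `θ` with a pairing `φ`:
`(φ ⊗ id)(θ(u) ⊗ v) + (φ ⊗ id)(u ⊗ θ(v)) = 0` for all local holomorphic sections `u`, `v` of `E`.
(This is an identity of sections of `L ⊗ K_X(D)`, checked off `D`.) -/
def IsCompatible (φ : ∀ x : Cpl D, E x.1 ⊗[ℂ] E x.1 →ₗ[ℂ] L x.1)
    (θ : ∀ x : Cpl D, Module.End ℂ (E x.1) ⊗[ℂ] Cotangent x.1) : Prop :=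
  ∀ (U : Opens X) (u v : ∀ x, E x), (∀ y ∈ U, HolAt FE u y) → (∀ y ∈ U, HolAt FE v y) →
    ∀ x : Cpl D, x.1 ∈ U →
      pairLeft (φ x) (higgsApply (θ x) (u x.1)) (v x.1) +
        pairRight (φ x) (u x.1) (higgsApply (θ x) (v x.1)) = 0

variable [∀ x, FiniteDimensional ℂ (E x)]
  (FL : Type*) [NormedAddCommGroup FL] [NormedSpace ℂ FL]
  [TopologicalSpace (TotalSpace FL L)] [∀ x, TopologicalSpace (L x)] [FiberBundle FL L]

/-- `φ` is a homomorphism `E_* ⊗ E_* → L_*` of parabolic bundles whose adjoint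
`E_* → E_*^* ⊗ L_*` is an isomorphism of parabolic bundles. -/
structure IsPerfect (P : ParabolicStructure D E) (Q : ParabolicStructure D L)
    (φ : ∀ x : Cpl D, E x.1 ⊗[ℂ] E x.1 →ₗ[ℂ] L x.1) : Prop where
  isHom : IsHom (tensor (P.filtered FE) (P.filtered FE)) (Q.filtered FL) φ
  isIso : IsIso (P.filtered FE) (tensor (dual (P.filtered FE)) (Q.filtered FL))
    (fun x => hat (φ x))

/-- An `L_*`-valued parabolic symplectic structure on `E_*`. -/
structure IsSymplectic (P : ParabolicStructure D E) (Q : ParabolicStructure D L)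
    (φ : ∀ x : Cpl D, E x.1 ⊗[ℂ] E x.1 →ₗ[ℂ] L x.1) : Prop extends IsPerfect FE FL P Q φ where
  antisymm : ∀ (x : Cpl D) (u v : E x.1), φ x (u ⊗ₜ v) = -φ x (v ⊗ₜ u)

/-- An `L_*`-valued parabolic orthogonal structure on `E_*`. -/
structure IsOrthogonal (P : ParabolicStructure D E) (Q : ParabolicStructure D L)
    (φ : ∀ x : Cpl D, E x.1 ⊗[ℂ] E x.1 →ₗ[ℂ] L x.1) : Prop extends IsPerfect FE FL P Q φ where
  symm : ∀ (x : Cpl D) (u v : E x.1), φ x (u ⊗ₜ v) = φ x (v ⊗ₜ u)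

variable {FE FL}

/-- The image of `θ` under the isomorphism
`End(E_*) ⊗ K_X(D) ≅ E_* ⊗ E_* ⊗ L_*^* ⊗ K_X(D)` induced by the adjoint of `φ`. -/
def higgsTensor {P : ParabolicStructure D E} {Q : ParabolicStructure D L}
    {φ : ∀ x : Cpl D, E x.1 ⊗[ℂ] E x.1 →ₗ[ℂ] L x.1} (hφ : IsPerfect FE FL P Q φ)
    (hL : ∀ x, Module.finrank ℂ (L x) = 1)
    (θ : ∀ x : Cpl D, Module.End ℂ (E x.1) ⊗[ℂ] Cotangent x.1) (x : Cpl D) :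
    ((E x.1 ⊗[ℂ] E x.1) ⊗[ℂ] Module.Dual ℂ (L x.1)) ⊗[ℂ] Cotangent x.1 :=
  LinearMap.rTensor (Cotangent x.1)
    (endEquiv (hL x.1) (LinearEquiv.ofBijective (hat (φ x)) (hφ.isIso.bijective x))).toLinearMap
    (θ x)

end Main

end Bundles

end ParabolicHiggs

end

/-!
Under the isomorphism `End V ≅ V ⊗ V ⊗ L^*` induced by a `∓`-symmetric perfect pairing
`φ : V ⊗ V → L`, exchanging the two factors `V` corresponds, up to sign, to taking the adjoint of an
endomorphism with respect to `φ`. Hence `θ` is skew-adjoint, that is, compatible with `φ`, if and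
only if its tensor is symmetric (`δ = 1`, symplectic case) or antisymmetric (`δ = -1`, orthogonal
case) in every fibre over `X ∖ D`.

It remains to see that such a tensor is a section of the parabolic symmetric or exterior square, not
only of the direct image of sections over `X ∖ D`. Near any point there are sections `b i` of `E_*`
and `c i` of its dual, of opposite degrees adapted to the weights, with `∑ c i ⊗ b i = id`. Writing
an endomorphism as `A = ∑ c i ⊗ A (b i)` shows that `End V ≅ V ⊗ V ⊗ L^*` is a homomorphism of
filtered sheaves. Finally the symmetrizer `s ↦ (s + δ sᵗ) / 2` maps `E_* ⊗ E_*` into its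
`δ`-symmetric part and fixes the `δ`-symmetric tensors.
-/

namespace ParabolicHiggs

section LinearAlgebra

theorem eq_zero_of_forall_rTensor_eq_zero {R M K ι : Type*} [CommRing R] [AddCommGroup M]
    [Module R M] [AddCommGroup K] [Module R K] [Module.Free R K] {N : ι → Type*}
    [∀ i, AddCommGroup (N i)] [∀ i, Module R (N i)] (f : ∀ i, M →ₗ[R] N i)
    (hf : ∀ m, (∀ i, f i m = 0) → m = 0) {z : M ⊗[R] K} (hz : ∀ i, (f i).rTensor K z = 0) :
    z = 0 := by
  classical
  let β := Module.Free.chooseBasis R K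
  have coord_rTensor (i) (w : M ⊗[R] K) (k) :
      TensorProduct.equivFinsuppOfBasisRight β ((f i).rTensor K w) k =
        f i (TensorProduct.equivFinsuppOfBasisRight β w k) := by
    induction w with
    | zero => simp
    | tmul m κ => simp
    | add v w hv hw => simp only [map_add, Finsupp.add_apply, hv, hw]
  apply (TensorProduct.equivFinsuppOfBasisRight β).injective
  ext k
  simpa using hf _ fun i => by rw [← coord_rTensor, hz, map_zero, Finsupp.zero_apply]

theorem dual_smul_comm_of_finrank_eq_one {R L : Type*} [CommRing R] [StrongRankCondition R]
    [AddCommGroup L] [Module R L] [Module.Free R L] (hL : Module.finrank R L = 1)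
    (l : Module.Dual R L) (a b : L) : l a • b = l b • a := by
  obtain ⟨e⟩ := Module.nonempty_linearEquiv_of_finrank_eq_one hL
  obtain ⟨r, rfl⟩ := e.surjective a
  obtain ⟨s, rfl⟩ := e.surjective b
  have hl (x : R) : l (e x) = x * l (e 1) := by simpa using map_smul (l ∘ₗ e.toLinearMap) x 1
  rw [← map_smul, ← map_smul, hl r, hl s, smul_eq_mul, smul_eq_mul]
  ring_nf

section DualFrame

variable {R M ι : Type*} [CommRing R] [AddCommGroup M] [Module R M] [Fintype ι]

/-- A finite family of vectors `b` with functionals `c` such that `∑ c i ⊗ b i` represents the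
identity of `M`. The vectors need not be independent. -/
def IsDualFrame (b : ι → M) (c : ι → Module.Dual R M) : Prop :=
  ∀ v, ∑ i, c i v • b i = v

theorem isDualFrame_coord (b : Module.Basis ι R M) : IsDualFrame b b.coord :=
  b.sum_repr

theorem IsDualFrame.map_eq_sum {b : ι → M} {c : ι → Module.Dual R M} (h : IsDualFrame b c)
    {N : Type*} [AddCommGroup N] [Module R N] (A : M →ₗ[R] N) (v : M) :
    A v = ∑ i, c i v • A (b i) := by
  conv_lhs => rw [← h v]
  simp only [map_sum, map_smul]

theorem IsDualFrame.sum_apply_eq_finrank [Module.Free R M] [Module.Finite R M] {b : ι → M}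
    {c : ι → Module.Dual R M} (h : IsDualFrame b c) :
    ∑ i, c i (b i) = Module.finrank R M := by
  have sum_eq_id : dualTensorHom R M M (∑ i, c i ⊗ₜ b i) = LinearMap.id := by
    ext v
    simpa [dualTensorHom_apply] using h v
  rw [← LinearMap.trace_id, ← sum_eq_id, LinearMap.trace_eq_contract_apply, map_sum]
  simp only [contractLeft_apply]

end DualFrame

theorem sum_castSucc_sub_succ {M : Type*} [AddCommGroup M] {n : ℕ} (g : Fin (n + 1) → M) :
    ∑ j : Fin n, (g j.castSucc - g j.succ) = g 0 - g (Fin.last n) := by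
  induction n with
  | zero => simp
  | succ n ih =>
    rw [Fin.sum_univ_castSucc]
    simp only [← Fin.castSucc_succ, ih (fun j => g j.castSucc)]
    simp

theorem exists_isDualFrame_adapted {k V : Type*} [Field k] [AddCommGroup V] [Module k V]
    [FiniteDimensional k V] {n : ℕ} {f : Fin (n + 1) → Submodule k V} (hf : Antitone f)
    (h_zero : f 0 = ⊤) (h_last : f (Fin.last n) = ⊥) :
    ∃ (ι : Type) (_ : Fintype ι) (j : ι → Fin n) (b : ι → V) (c : ι → Module.Dual k V),
      IsDualFrame b c ∧ ∀ i, b i ∈ f (j i).castSucc ∧ ∀ v ∈ f (j i).succ, c i v = 0 := by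
  have exists_isProj (j) : ∃ p : V →ₗ[k] V, LinearMap.IsProj (f j) p := by
    obtain ⟨W, hW⟩ := (f j).exists_isCompl
    exact ⟨(f j).projection W hW, ⟨(f j).projection_apply_mem hW,
      fun _ => (f j).projection_apply_of_mem_left hW⟩⟩
  choose p hp using exists_isProj
  let β := Module.finBasis k V
  -- The identity is the telescoping sum of the differences `q j` of consecutive projections.
  let q (j : Fin n) : V →ₗ[k] V := p j.castSucc - p j.succ
  have map_q (j v) : p j.castSucc (q j v) = q j v :=
    (hp _).map_id _ <| sub_mem ((hp _).map_mem v)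
      (hf (Fin.castSucc_lt_succ).le ((hp _).map_mem v))
  refine ⟨Fin n × Fin (Module.finrank k V), inferInstance, Prod.fst,
    fun i => p i.1.castSucc (β i.2), fun i => β.coord i.2 ∘ₗ q i.1, fun v => ?_,
    fun i => ⟨(hp _).map_mem _, fun v hv => ?_⟩⟩
  · simp only [LinearMap.comp_apply, Fintype.sum_prod_type,
      ← (isDualFrame_coord β).map_eq_sum, map_q]
    simp only [q, LinearMap.sub_apply, sum_castSucc_sub_succ fun j => p j v]
    have map_last : p (Fin.last n) v ∈ f (Fin.last n) := (hp _).map_mem v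
    rw [h_last, Submodule.mem_bot] at map_last
    rw [map_last, sub_zero, (hp 0).map_id v (h_zero ▸ trivial)]
  · have : q i.1 v = 0 := by
      rw [LinearMap.sub_apply, (hp _).map_id v hv,
        (hp _).map_id v (hf (Fin.castSucc_lt_succ).le hv), sub_self]
    rw [LinearMap.comp_apply, this, map_zero]

/-- The exchange of the two factors `V` in `V ⊗ V ⊗ W`. -/
noncomputable def exchange (R V W : Type*) [CommRing R] [AddCommGroup V] [Module R V]
    [AddCommGroup W] [Module R W] : (V ⊗[R] V) ⊗[R] W →ₗ[R] (V ⊗[R] V) ⊗[R] W :=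
  (TensorProduct.comm R V V).toLinearMap.rTensor W

@[simp]
theorem exchange_tmul {R V W : Type*} [CommRing R] [AddCommGroup V] [Module R V]
    [AddCommGroup W] [Module R W] (s : V ⊗[R] V) (w : W) :
    exchange R V W (s ⊗ₜ w) = TensorProduct.comm R V V s ⊗ₜ w :=
  rfl

/-- The projection `s ↦ (s + δ sᵗ) / 2` of `V ⊗ V` onto the tensors with `sᵗ = δ s`, where
`δ = ±1` and `sᵗ` is obtained from `s` by exchanging the factors. -/
noncomputable def signedSymmetrizer {k : Type*} (V : Type*) [Field k] [AddCommGroup V]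
    [Module k V] (δ : k) : V ⊗[k] V →ₗ[k] V ⊗[k] V :=
  (2⁻¹ : k) • (LinearMap.id + δ • (TensorProduct.comm k V V).toLinearMap)

section SignedSymmetrizer

variable {k V : Type*} [Field k] [AddCommGroup V] [Module k V] {δ : k}

theorem signedSymmetrizer_tmul (u v : V) :
    signedSymmetrizer V δ (u ⊗ₜ v) = ((2⁻¹ : k) • u) ⊗ₜ v + ((2⁻¹ * δ) • v) ⊗ₜ u := by
  simp [signedSymmetrizer, TensorProduct.smul_tmul', smul_smul]

theorem comm_signedSymmetrizer (hδ : δ * δ = 1) (s : V ⊗[k] V) :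
    TensorProduct.comm k V V (signedSymmetrizer V δ s) = δ • signedSymmetrizer V δ s := by
  have comm_comm : TensorProduct.comm k V V (TensorProduct.comm k V V s) = s :=
    (TensorProduct.comm k V V).symm_apply_apply s
  simp only [signedSymmetrizer, LinearMap.smul_apply, LinearMap.add_apply, LinearMap.id_apply,
    LinearEquiv.coe_coe, map_smul, map_add, comm_comm]
  rw [smul_comm δ, smul_add δ, smul_smul δ δ, hδ, one_smul, add_comm (δ • s)]

theorem rTensor_rTensor_signedSymmetrizer [NeZero (2 : k)] (hδ : δ * δ = 1) {W K : Type*}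
    [AddCommGroup W] [Module k W] [AddCommGroup K] [Module k K] {T : ((V ⊗[k] V) ⊗[k] W) ⊗[k] K}
    (hT : (exchange k V W).rTensor K T = δ • T) :
    ((signedSymmetrizer V δ).rTensor W).rTensor K T = T := by
  simp only [signedSymmetrizer, LinearMap.rTensor_smul, LinearMap.rTensor_add,
    LinearMap.rTensor_id, LinearMap.smul_apply, LinearMap.add_apply, LinearMap.id_apply]
  change (2⁻¹ : k) • (T + δ • (exchange k V W).rTensor K T) = T
  rw [hT, smul_smul, hδ, one_smul, ← two_smul k, inv_smul_smul₀ two_ne_zero]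

end SignedSymmetrizer

variable {V L K : Type*} [AddCommGroup V] [Module ℂ V] [FiniteDimensional ℂ V]
  [AddCommGroup L] [Module ℂ L] [AddCommGroup K] [Module ℂ K]

theorem dualTensorHom_hat (φ : V ⊗[ℂ] V →ₗ[ℂ] L) (u v : V) :
    dualTensorHom ℂ V L (hat φ u) v = φ (u ⊗ₜ v) :=
  LinearMap.congr_fun ((dualTensorHomEquiv ℂ V L).apply_symm_apply (TensorProduct.curry φ u)) v

theorem eq_zero_of_forall_pairing_eq_zero {φ : V ⊗[ℂ] V →ₗ[ℂ] L}
    (hφ : Function.Injective (hat φ)) {A : Module.End ℂ V} (hA : ∀ u v, φ (A u ⊗ₜ v) = 0) :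
    A = 0 := by
  ext u
  apply hφ
  apply (dualTensorHomEquiv ℂ V L).injective
  ext v
  change dualTensorHom ℂ V L _ v = dualTensorHom ℂ V L _ v
  rw [dualTensorHom_hat, dualTensorHom_hat, hA]
  simp

theorem endEquiv_symm_tmul (hL : Module.finrank ℂ L = 1) (e : V ≃ₗ[ℂ] Module.Dual ℂ V ⊗[ℂ] L)
    (w h : V) (l : Module.Dual ℂ L) (u : V) :
    (endEquiv hL e).symm ((w ⊗ₜ h) ⊗ₜ l) u = l (dualTensorHom ℂ V L (e h) u) • w := by
  have key (z : Module.Dual ℂ V ⊗[ℂ] L) :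
      (endEquiv hL e).symm ((w ⊗ₜ e.symm z) ⊗ₜ l) u = l (dualTensorHom ℂ V L z u) • w := by
    induction z with
    | zero => simp
    | tmul f a => simp [endEquiv, lineContract, dualTensorHomEquiv, smul_smul, mul_comm (f u)]
    | add z z' hz hz' =>
      simp only [map_add, TensorProduct.tmul_add, TensorProduct.add_tmul, LinearMap.add_apply,
        hz, hz', add_smul]
  simpa using key (e h)

theorem endEquiv_eq_sum (hL : Module.finrank ℂ L = 1) (e : V ≃ₗ[ℂ] Module.Dual ℂ V ⊗[ℂ] L)
    {ι κ : Type*} [Fintype ι] [Fintype κ] {b : ι → V} {c : ι → Module.Dual ℂ V}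
    (hb : IsDualFrame b c) {m : κ → L} {l : κ → Module.Dual ℂ L} (hm : IsDualFrame m l)
    (A : Module.End ℂ V) :
    endEquiv hL e A =
      ∑ i : ι × κ, (A (b i.1) ⊗ₜ e.symm (c i.1 ⊗ₜ m i.2)) ⊗ₜ l i.2 := by
  have : Module.Finite ℂ L := Module.finite_of_finrank_eq_succ hL
  rw [← LinearEquiv.eq_symm_apply]
  ext u
  simp only [map_sum, LinearMap.sum_apply, endEquiv_symm_tmul, e.apply_symm_apply,
    dualTensorHom_apply, map_smul, smul_eq_mul, Fintype.sum_prod_type, ← Finset.sum_smul,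
    ← Finset.mul_sum, hm.sum_apply_eq_finrank, hL, Nat.cast_one, mul_one]
  exact hb.map_eq_sum A u

theorem pairing_endEquiv_symm_exchange (hL : Module.finrank ℂ L = 1)
    {φ : V ⊗[ℂ] V →ₗ[ℂ] L} {e : V ≃ₗ[ℂ] Module.Dual ℂ V ⊗[ℂ] L} (he : ∀ u, e u = hat φ u)
    (T : (V ⊗[ℂ] V) ⊗[ℂ] Module.Dual ℂ L) (u v : V) :
    φ ((endEquiv hL e).symm (exchange ℂ V _ T) u ⊗ₜ v) =
      φ ((endEquiv hL e).symm T v ⊗ₜ u) := by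
  induction T with
  | zero => simp
  | add S T hS hT => simp only [map_add, LinearMap.add_apply, TensorProduct.add_tmul, hS, hT]
  | tmul s l =>
    induction s with
    | zero => simp
    | add s t hs ht =>
      simp only [TensorProduct.add_tmul, map_add, LinearMap.add_apply, hs, ht]
    | tmul w h =>
      simp only [exchange_tmul, TensorProduct.comm_tmul, endEquiv_symm_tmul, he,
        dualTensorHom_hat, ← TensorProduct.smul_tmul', map_smul]
      exact dual_smul_comm_of_finrank_eq_one hL l _ _

theorem forall_pairLeft_add_pairRight_eq_zero_iff (hL : Module.finrank ℂ L = 1)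
    {φ : V ⊗[ℂ] V →ₗ[ℂ] L} {e : V ≃ₗ[ℂ] Module.Dual ℂ V ⊗[ℂ] L} (he : ∀ u, e u = hat φ u)
    {δ : ℂ} (hδ : δ * δ = 1) (hφ : ∀ u v, φ (u ⊗ₜ v) = -δ • φ (v ⊗ₜ u))
    (θ : Module.End ℂ V ⊗[ℂ] K) :
    (∀ u v, pairLeft φ (higgsApply θ u) v + pairRight φ u (higgsApply θ v) = 0) ↔
      (exchange ℂ V _).rTensor K ((endEquiv hL e).toLinearMap.rTensor K θ) =
        δ • (endEquiv hL e).toLinearMap.rTensor K θ := by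
  let E := endEquiv hL e
  let S := exchange ℂ V (Module.Dual ℂ L)
  let asymmetry : Module.End ℂ V →ₗ[ℂ] (V ⊗[ℂ] V) ⊗[ℂ] Module.Dual ℂ L :=
    E.toLinearMap - δ • S ∘ₗ E.toLinearMap
  let ev (uv : V × V) : (V ⊗[ℂ] V) ⊗[ℂ] Module.Dual ℂ L →ₗ[ℂ] L :=
    (TensorProduct.curry φ).flip uv.2 ∘ₗ LinearMap.applyₗ uv.1 ∘ₗ E.symm.toLinearMap
  have ev_asymmetry (u v) : pairLeft φ (higgsApply θ u) v + pairRight φ u (higgsApply θ v) =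
      (ev (u, v)).rTensor K (asymmetry.rTensor K θ) := by
    simp only [pairLeft, pairRight, higgsApply, ← LinearMap.rTensor_comp_apply,
      ← LinearMap.add_apply, ← LinearMap.rTensor_add]
    congr 2
    ext A
    have adjoint_apply := pairing_endEquiv_symm_exchange hL he (E A) u v
    rw [LinearEquiv.symm_apply_apply] at adjoint_apply
    simp [ev, asymmetry, S, E, adjoint_apply, hφ u (A v), sub_eq_add_neg]
  have ev_injective (T) (hT : ∀ uv, ev uv T = 0) : T = 0 :=
    E.symm.map_eq_zero_iff.1 <| eq_zero_of_forall_pairing_eq_zero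
      (fun u v h => e.injective (by rwa [he, he])) fun u v => hT (u, v)
  calc (∀ u v, pairLeft φ (higgsApply θ u) v + pairRight φ u (higgsApply θ v) = 0)
      ↔ asymmetry.rTensor K θ = 0 := by
        simp only [ev_asymmetry]
        exact ⟨fun h => eq_zero_of_forall_rTensor_eq_zero ev ev_injective fun uv => h uv.1 uv.2,
          fun h u v => by rw [h, map_zero]⟩
    _ ↔ E.toLinearMap.rTensor K θ = δ • S.rTensor K (E.toLinearMap.rTensor K θ) := by
        rw [LinearMap.rTensor_sub, LinearMap.rTensor_smul, LinearMap.rTensor_comp,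
          ← sub_eq_zero (a := E.toLinearMap.rTensor K θ)]
        rfl
    _ ↔ S.rTensor K (E.toLinearMap.rTensor K θ) = δ • E.toLinearMap.rTensor K θ :=
        ⟨fun h => by conv_rhs => rw [h, smul_smul, hδ, one_smul],
          fun h => by rw [h, smul_smul, hδ, one_smul]⟩

end LinearAlgebra

section FilteredSheaves

variable {X : Type*} [TopologicalSpace X] {D : Finset X} {V V' W : Cpl D → Type*}
  [∀ x, AddCommGroup (V x)] [∀ x, Module ℂ (V x)] [∀ x, AddCommGroup (V' x)]
  [∀ x, Module ℂ (V' x)] [∀ x, AddCommGroup (W x)] [∀ x, Module ℂ (W x)]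
  {P : Filtered D V} {P' : Filtered D V'} {Q : Filtered D W} {t : ℝ} {U : Opens X}

theorem mem_tensor_iff {σ : ∀ x, V x ⊗[ℂ] W x} :
    σ ∈ tensor P Q t U ↔ ∀ y ∈ U, ∃ N : Opens X, y ∈ N ∧ N ≤ U ∧
      ∃ (ι : Type) (_ : Fintype ι) (a b : ι → ℝ) (e : ι → ∀ x, V x) (f : ι → ∀ x, W x),
        (∀ k, t ≤ a k + b k ∧ e k ∈ P (a k) N ∧ f k ∈ Q (b k) N) ∧
        ∀ x : Cpl D, x.1 ∈ N → σ x = ∑ k, e k x ⊗ₜ[ℂ] f k x := by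
  refine ⟨fun h y hy => ?_, fun h y hy => ?_⟩
  · obtain ⟨N, hyN, hNU, n, h⟩ := h y hy
    exact ⟨N, hyN, hNU, Fin n, inferInstance, h⟩
  · obtain ⟨N, hyN, hNU, ι, _, a, b, e, f, hef, hσ⟩ := h y hy
    let r := (Fintype.equivFin ι).symm
    refine ⟨N, hyN, hNU, Fintype.card ι, a ∘ r, b ∘ r, e ∘ r, f ∘ r, fun k => hef (r k),
      fun x hx => ?_⟩
    rw [hσ x hx, ← r.sum_comp]
    rfl

theorem tmul_mem_tensor {a b : ℝ} {e : ∀ x, V x} {f : ∀ x, W x} (he : e ∈ P a U)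
    (hf : f ∈ Q b U) : (fun x => e x ⊗ₜ[ℂ] f x) ∈ tensor P Q (a + b) U :=
  mem_tensor_iff.2 fun _ hy => ⟨U, hy, le_rfl, Unit, inferInstance, fun _ => a, fun _ => b,
    fun _ => e, fun _ => f, fun _ => ⟨le_rfl, he, hf⟩, fun _ _ => by simp⟩

theorem tensor_congr {σ τ : ∀ x, V x ⊗[ℂ] W x} (hσ : σ ∈ tensor P Q t U)
    (h : ∀ x : Cpl D, x.1 ∈ U → σ x = τ x) : τ ∈ tensor P Q t U := by
  intro y hy
  obtain ⟨N, hyN, hNU, n, a, b, e, f, hef, hsum⟩ := hσ y hy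
  exact ⟨N, hyN, hNU, n, a, b, e, f, hef, fun x hx => (h x (hNU hx)).symm.trans (hsum x hx)⟩

theorem IsHom.rTensor {f : ∀ x, V x →ₗ[ℂ] V' x} (hf : IsHom P P' f) (Q : Filtered D W) :
    IsHom (tensor P Q) (tensor P' Q) fun x => (f x).rTensor (W x) := by
  intro t U σ hσ y hy
  obtain ⟨N, hyN, hNU, n, a, b, e, g, heg, hsum⟩ := hσ y hy
  refine ⟨N, hyN, hNU, n, a, b, fun k x => f x (e k x), g,
    fun k => ⟨(heg k).1, hf _ _ _ (heg k).2.1, (heg k).2.2⟩, fun x hx => ?_⟩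
  simp only [hsum x hx, map_sum, LinearMap.rTensor_tmul]

theorem rTensor_eq_smul_of_mem_tensor {f : ∀ x, V x →ₗ[ℂ] V x} {δ : ℂ}
    (hf : ∀ t U, ∀ s ∈ P t U, ∀ x : Cpl D, x.1 ∈ U → f x (s x) = δ • s x)
    {σ : ∀ x, V x ⊗[ℂ] W x} (hσ : σ ∈ tensor P Q t U) (x : Cpl D) (hx : x.1 ∈ U) :
    (f x).rTensor (W x) (σ x) = δ • σ x := by
  obtain ⟨N, hxN, -, n, a, b, e, h, heh, hsum⟩ := hσ x.1 hx
  simp only [hsum x hxN, map_sum, LinearMap.rTensor_tmul, hf _ _ _ (heh _).2.1 x hxN,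
    Finset.smul_sum, TensorProduct.smul_tmul']

theorem IsIso.isHom_symm {f : ∀ x, V x →ₗ[ℂ] V' x} (hf : IsIso P P' f) :
    IsHom P' P fun x => (LinearEquiv.ofBijective (f x) (hf.bijective x)).symm.toLinearMap := by
  obtain ⟨-, g, hg, hgf, -⟩ := id hf
  have symm_eq (x) :
      (LinearEquiv.ofBijective (f x) (hf.bijective x)).symm.toLinearMap = g x := by
    ext w
    obtain ⟨v, rfl⟩ := (hf.bijective x).2 w
    rw [LinearEquiv.coe_coe, LinearEquiv.ofBijective_symm_apply_apply]
    exact (LinearMap.congr_fun (hgf x) v).symm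
  simpa only [symm_eq] using hg

section SignedSquare

/-- The subsheaf of the parabolic tensor square formed by the tensors that are multiplied by `δ`
when their factors are exchanged; the parabolic symmetric and exterior squares are the cases
`δ = 1` and `δ = -1`. -/
def signedSquare (δ : ℂ) (P : Filtered D V) : Filtered D fun x => V x ⊗[ℂ] V x :=
  fun t U => {σ | σ ∈ tensor P P t U ∧
    ∀ x : Cpl D, x.1 ∈ U → TensorProduct.comm ℂ (V x) (V x) (σ x) = δ • σ x}

theorem signedSquare_one (P : Filtered D V) : signedSquare 1 P = sym2 P := by
  funext t U
  ext σ
  simp only [signedSquare, sym2, Set.mem_ofPred_eq, one_smul]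

theorem signedSquare_neg_one (P : Filtered D V) : signedSquare (-1) P = wedge2 P := by
  funext t U
  ext σ
  simp only [signedSquare, wedge2, Set.mem_ofPred_eq, neg_one_smul]

theorem isHom_signedSymmetrizer (hP : ∀ a : ℂ, IsHom P P fun _ => a • LinearMap.id) {δ : ℂ}
    (hδ : δ * δ = 1) :
    IsHom (tensor P P) (signedSquare δ P) fun x => signedSymmetrizer (V x) δ := by
  intro t U σ hσ
  refine ⟨mem_tensor_iff.2 fun y hy => ?_, fun x _ => comm_signedSymmetrizer hδ _⟩
  obtain ⟨N, hyN, hNU, n, a, b, e, f, hef, hsum⟩ := hσ y hy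
  refine ⟨N, hyN, hNU, Fin n ⊕ Fin n, inferInstance, Sum.elim a b, Sum.elim b a,
    Sum.elim (fun k x => (2⁻¹ : ℂ) • e k x) (fun k x => (2⁻¹ * δ) • f k x), Sum.elim f e,
    ?_, fun x hx => ?_⟩
  · rintro (k | k)
    · exact ⟨(hef k).1, hP _ _ _ _ (hef k).2.1, (hef k).2.2⟩
    · exact ⟨(hef k).1.trans_eq (add_comm _ _), hP _ _ _ _ (hef k).2.2, (hef k).2.1⟩
  · simp only [hsum x hx, map_sum, signedSymmetrizer_tmul, Finset.sum_add_distrib,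
      Fintype.sum_sum_type, Sum.elim_inl, Sum.elim_inr]

theorem mem_tensor_tensor_signedSquare_iff (hP : ∀ a : ℂ, IsHom P P fun _ => a • LinearMap.id)
    {δ : ℂ} (hδ : δ * δ = 1) {R : Filtered D V'}
    {T : ∀ x, ((V x ⊗[ℂ] V x) ⊗[ℂ] W x) ⊗[ℂ] V' x} :
    T ∈ tensor (tensor (signedSquare δ P) Q) R t U ↔
      T ∈ tensor (tensor (tensor P P) Q) R t U ∧
        ∀ x : Cpl D, x.1 ∈ U → (exchange ℂ (V x) (W x)).rTensor (V' x) (T x) = δ • T x := by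
  refine ⟨fun hT => ⟨?_, fun x hx => ?_⟩, fun ⟨hT, hδT⟩ => ?_⟩
  · have isHom_id : IsHom (signedSquare δ P) (tensor P P) fun _ => LinearMap.id :=
      fun _ _ _ hσ => hσ.1
    simpa only [LinearMap.rTensor_id, LinearMap.id_apply] using
      (isHom_id.rTensor Q).rTensor R _ _ _ hT
  · have exchange_eq (t U) (S) (hS : S ∈ tensor (signedSquare δ P) Q t U) :=
      rTensor_eq_smul_of_mem_tensor
        (f := fun x => (TensorProduct.comm ℂ (V x) (V x)).toLinearMap) (fun _ _ _ h => h.2) hS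
    exact rTensor_eq_smul_of_mem_tensor exchange_eq hT x hx
  · exact tensor_congr (((isHom_signedSymmetrizer hP hδ).rTensor Q).rTensor R _ _ _ hT)
      fun x hx => rTensor_rTensor_signedSymmetrizer hδ (hδT x hx)

end SignedSquare

section HomSheaf

/-- The filtered sheaf of homomorphisms: its sections of degree `t` raise the degree by `t`. -/
def homSheaf (P : Filtered D V) (Q : Filtered D W) : Filtered D fun x => V x →ₗ[ℂ] W x :=
  fun t U => {A | ∀ N ≤ U, ∀ (a : ℝ) (e : ∀ x, V x), e ∈ P a N →
    (fun x => A x (e x)) ∈ Q (a + t) N}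

variable [ChartedSpace ℂ X]

/-- Near every point there are finitely many sections `b i` of `P` and `c i` of the dual of `P`, of
opposite degrees, with `∑ c i ⊗ b i = id`. For the filtered sheaf of a parabolic bundle this is
local freeness, with the degrees adapted to the weights. -/
def HasLocalFrames (P : Filtered D V) : Prop :=
  ∀ y : X, ∃ N : Opens X, y ∈ N ∧ ∃ (ι : Type) (_ : Fintype ι) (a : ι → ℝ)
    (b : ι → ∀ x, V x) (c : ι → ∀ x, Module.Dual ℂ (V x)),
    (∀ N' ≤ N, ∀ i, b i ∈ P (a i) N' ∧ c i ∈ dual P (-a i) N') ∧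
    ∀ x : Cpl D, x.1 ∈ N → IsDualFrame (fun i => b i x) fun i => c i x

theorem isHom_endEquiv [∀ x, FiniteDimensional ℂ (V x)] (hW : ∀ x, Module.finrank ℂ (W x) = 1)
    (hP : HasLocalFrames P) (hQ : HasLocalFrames Q)
    {e : ∀ x, V x ≃ₗ[ℂ] Module.Dual ℂ (V x) ⊗[ℂ] W x}
    (he : IsHom (tensor (dual P) Q) P fun x => (e x).symm.toLinearMap) :
    IsHom (homSheaf P P) (tensor (tensor P P) (dual Q))
      fun x => (endEquiv (hW x) (e x)).toLinearMap := by
  intro t U A hA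
  refine mem_tensor_iff.2 fun y hy => ?_
  obtain ⟨N₁, hyN₁, ι, _, a, b, c, hbc, frame_bc⟩ := hP y
  obtain ⟨N₂, hyN₂, κ, _, d, m, l, hml, frame_ml⟩ := hQ y
  let N := U ⊓ (N₁ ⊓ N₂)
  replace hbc := hbc N (inf_le_right.trans inf_le_left)
  replace hml := hml N (inf_le_right.trans inf_le_right)
  refine ⟨N, ⟨hy, hyN₁, hyN₂⟩, inf_le_left, ι × κ, inferInstance,
    fun i => (a i.1 + t) + (-a i.1 + d i.2), fun i => -d i.2,
    fun i x => A x (b i.1 x) ⊗ₜ (e x).symm (c i.1 x ⊗ₜ m i.2 x), fun i => l i.2,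
    fun i => ⟨by linarith, ?_, (hml _).2⟩, fun x hx => ?_⟩
  · exact tmul_mem_tensor (hA N inf_le_left _ _ (hbc _).1)
      (he _ _ _ (tmul_mem_tensor (hbc _).2 (hml _).1))
  · exact endEquiv_eq_sum (hW x) (e x) (frame_bc x hx.2.1) (frame_ml x hx.2.2) (A x)

end HomSheaf

end FilteredSheaves

section Germs

variable {X : Type*} [TopologicalSpace X] [ChartedSpace ℂ X]
  {F : Type*} [NormedAddCommGroup F] [NormedSpace ℂ F]

theorem holAt_trivial_iff {g : X → F} {y : X} :
    HolAt (E := Bundle.Trivial X F) F g y ↔ ContMDiffAt 𝓘(ℂ, ℂ) 𝓘(ℂ, F) ω g y :=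
  contMDiffAt_section (E := Bundle.Trivial X F) y

theorem exists_eventually_eq_chartAt_sub_smul [IsManifold 𝓘(ℂ, ℂ) ω X] [CompleteSpace F]
    {g : X → F} {y : X} (hg : ContMDiffAt 𝓘(ℂ, ℂ) 𝓘(ℂ, F) ω g y) (hgy : g y = 0) :
    ∃ q : X → F, ContMDiffAt 𝓘(ℂ, ℂ) 𝓘(ℂ, F) ω q y ∧
      ∀ᶠ x in 𝓝 y, g x = (chartAt ℂ y x - chartAt ℂ y y) • q x := by
  let z := chartAt ℂ y
  let G := g ∘ z.symm
  have y_mem : y ∈ z.source := mem_chart_source ℂ y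
  have symm_holo : ContMDiffAt 𝓘(ℂ, ℂ) 𝓘(ℂ, ℂ) ω z.symm (z y) :=
    (contMDiffOn_chart_symm (I := 𝓘(ℂ, ℂ)) (x := y)).contMDiffAt
      (z.open_target.mem_nhds (z.map_source y_mem))
  have G_holo : ContMDiffAt 𝓘(ℂ, ℂ) 𝓘(ℂ, F) ω G (z y) :=
    ContMDiffAt.comp (z y) (by rwa [z.left_inv y_mem]) symm_holo
  obtain ⟨p, hp⟩ := (contMDiffAt_iff_contDiffAt.1 G_holo).analyticAt
  have dslope_holo : AnalyticAt ℂ (dslope G (z y)) (z y) := ⟨_, hp.has_fpower_series_dslope_fslope⟩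
  refine ⟨dslope G (z y) ∘ z, ContMDiffAt.comp y
    (contMDiffAt_iff_contDiffAt.2 dslope_holo.contDiffAt)
    ((contMDiffOn_chart (I := 𝓘(ℂ, ℂ)) (x := y)).contMDiffAt (z.open_source.mem_nhds y_mem)), ?_⟩
  filter_upwards [z.open_source.mem_nhds y_mem] with x hx
  simpa only [G, Function.comp_apply, z.left_inv hx, z.left_inv y_mem, hgy, sub_zero] using
    (sub_smul_dslope G (z y) (z x)).symm

variable {D : Finset X}

theorem GermAt.add_one_of_bot [IsManifold 𝓘(ℂ, ℂ) ω X] [CompleteSpace F] {y : X} (hy : y ∈ D)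
    {m : ℤ} {s : Cpl D → F} (hs : GermAt (E := Bundle.Trivial X F) F y m ⊥ s) :
    GermAt (E := Bundle.Trivial X F) F y (m + 1) ⊤ s := by
  obtain ⟨g, hg, hgy, hsg⟩ := hs
  obtain ⟨q, hq, hgq⟩ := exists_eventually_eq_chartAt_sub_smul (holAt_trivial_iff.1 hg) hgy
  refine ⟨q, holAt_trivial_iff.2 hq, trivial, ?_⟩
  filter_upwards [hsg, hgq, (chartAt ℂ y).open_source.mem_nhds (mem_chart_source ℂ y)]
    with x hsx hqx hx hxD
  have coord_ne_zero : chartAt ℂ y x - chartAt ℂ y y ≠ 0 := fun h =>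
    hxD ((chartAt ℂ y).injOn hx (mem_chart_source ℂ y) (sub_eq_zero.1 h) ▸ hy)
  rw [hsx hxD, hqx, zpow_add_one₀ coord_ne_zero, mul_smul]

variable {E : X → Type*} [TopologicalSpace (TotalSpace F E)] [∀ x, TopologicalSpace (E x)]
  [FiberBundle F E] [∀ x, AddCommGroup (E x)] [∀ x, Module ℂ (E x)]

theorem HolAt.const_smul [VectorBundle ℂ F E] {g : ∀ x, E x} {y : X} (hg : HolAt F g y) (a : ℂ) :
    HolAt F (fun x => a • g x) y :=
  ContMDiffAt.const_smul_section hg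

theorem HolAt.germAt {g : ∀ x, E x} {y : X} (hg : HolAt F g y) {S : Submodule ℂ (E y)}
    (hS : g y ∈ S) : GermAt F y 0 S fun x : Cpl D => g x :=
  ⟨g, hg, hS, by simp⟩

theorem GermAt.map {F' : Type*} [NormedAddCommGroup F'] [NormedSpace ℂ F'] {E' : X → Type*}
    [TopologicalSpace (TotalSpace F' E')] [∀ x, TopologicalSpace (E' x)] [FiberBundle F' E']
    [∀ x, AddCommGroup (E' x)] [∀ x, Module ℂ (E' x)] {y : X} {m : ℤ} {S : Submodule ℂ (E y)}
    {S' : Submodule ℂ (E' y)} {s : ∀ x : Cpl D, E x.1} (hs : GermAt F y m S s)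
    {A : ∀ x, E x →ₗ[ℂ] E' x}
    (hA : ∀ g : ∀ x, E x, HolAt F g y → HolAt F' (fun x => A x (g x)) y)
    (hS : S ≤ S'.comap (A y)) : GermAt F' y m S' fun x => A x.1 (s x) := by
  obtain ⟨g, hg, hgS, hsg⟩ := hs
  refine ⟨_, hA g hg, hS hgS, hsg.mono fun x hx hxD => ?_⟩
  simp only [hx hxD, map_smul]

end Germs

section Transport

variable {X F : Type*} [TopologicalSpace X] [NormedAddCommGroup F] [NormedSpace ℂ F]
  {E : X → Type*} [TopologicalSpace (TotalSpace F E)] [∀ x, AddCommGroup (E x)]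
  [∀ x, Module ℂ (E x)]

/-- The linear map from the fibre over `x` to the fibre over `y` that is the identity in the
trivialization `e`; it is used to extend vectors and functionals in one fibre to holomorphic
sections near it. It is `0` if `x` or `y` lies outside the base set of `e`. -/
noncomputable def transport (e : Trivialization F (TotalSpace.proj : TotalSpace F E → X))
    [e.IsLinear ℂ] (x y : X) : E x →ₗ[ℂ] E y :=
  e.symmₗ ℂ y ∘ₗ e.linearMapAt ℂ x

variable {e : Trivialization F (TotalSpace.proj : TotalSpace F E → X)}

section Linear

variable [e.IsLinear ℂ] {x y : X}

theorem transport_self (hx : x ∈ e.baseSet) (v : E x) : transport e x x v = v :=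
  e.symmₗ_linearMapAt hx v

theorem transport_transport (hx : x ∈ e.baseSet) (hy : y ∈ e.baseSet) (v : E x) :
    transport e y x (transport e x y v) = v := by
  rw [transport, transport, LinearMap.comp_apply, LinearMap.comp_apply, e.linearMapAt_symmₗ hy,
    e.symmₗ_linearMapAt hx]

theorem IsDualFrame.transport {ι : Type*} [Fintype ι] {b : ι → E y} {c : ι → Module.Dual ℂ (E y)}
    (h : IsDualFrame b c) (hx : x ∈ e.baseSet) (hy : y ∈ e.baseSet) :
    IsDualFrame (fun i => transport e y x (b i)) fun i => c i ∘ₗ transport e x y := by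
  intro v
  simp only [LinearMap.comp_apply, ← h.map_eq_sum, transport_transport hx hy]

end Linear

variable [ChartedSpace ℂ X] [∀ x, TopologicalSpace (E x)] [FiberBundle F E] [VectorBundle ℂ F E]
  [ContMDiffVectorBundle ω F E 𝓘(ℂ, ℂ)] [MemTrivializationAtlas e] {x : X}

theorem holAt_transport (y : X) (v : E y) (hx : x ∈ e.baseSet) :
    HolAt F (fun x => transport e y x v) x := by
  rw [HolAt, Trivialization.contMDiffAt_section_iff e hx]
  refine (contMDiffAt_const (c := e.linearMapAt ℂ y v)).congr_of_eventuallyEq ?_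
  filter_upwards [e.open_baseSet.mem_nhds hx] with x' hx'
  rw [← e.linearMapAt_symmₗ (R := ℂ) hx' (e.linearMapAt ℂ y v),
    Trivialization.coe_linearMapAt_of_mem _ hx']
  rfl

theorem HolAt.apply_transport {y : X} [FiniteDimensional ℂ (E y)] (c : Module.Dual ℂ (E y))
    (hy : y ∈ e.baseSet) {g : ∀ x, E x} (hg : HolAt F g x) (hx : x ∈ e.baseSet) :
    HolAt (E := Bundle.Trivial X ℂ) ℂ (fun x => c (transport e x y (g x))) x := by
  have : FiniteDimensional ℂ F := (e.linearEquivAt ℂ y hy).finiteDimensional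
  let l : F →L[ℂ] ℂ := (c ∘ₗ e.symmₗ ℂ y).toContinuousLinearMap
  rw [HolAt, Trivialization.contMDiffAt_section_iff e hx] at hg
  refine holAt_trivial_iff.2
    ((ContMDiffAt.comp x l.contDiff.contMDiff.contMDiffAt hg).congr_of_eventuallyEq ?_)
  filter_upwards [e.open_baseSet.mem_nhds hx] with x' hx'
  simp only [transport, LinearMap.comp_apply, Trivialization.coe_linearMapAt_of_mem _ hx']
  rfl

end Transport

section Ceil

variable {k : Type*} [Field k] [LinearOrder k] [IsStrictOrderedRing k] [FloorRing k] {a t : k}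

theorem ceil_sub_eq_floor (ha : a < 1) (hta : Int.fract t ≤ a) : ⌈t - a⌉ = ⌊t⌋ := by
  have := Int.floor_add_fract t
  have := Int.fract_nonneg t
  rw [Int.ceil_eq_iff]
  constructor <;> linarith

theorem ceil_sub_eq_floor_add_one (ha : 0 ≤ a) (hat : a < Int.fract t) :
    ⌈t - a⌉ = ⌊t⌋ + 1 := by
  have := Int.floor_add_fract t
  have := Int.fract_lt_one t
  rw [Int.ceil_eq_iff]
  push_cast
  constructor <;> linarith

end Ceil

namespace ParabolicStructure

section Flags

variable {X : Type*} {D : Finset X} {E : X → Type*} [∀ x, AddCommGroup (E x)]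
  [∀ x, Module ℂ (E x)] (P : ParabolicStructure D E) (p : D)

theorem flag_le_flagAt {τ : ℝ} {j : Fin (P.len p)} (hτ : τ ≤ P.weight p j) :
    P.flag p j.castSucc ≤ P.flagAt p τ :=
  le_iSup₂_of_le (f := fun k (_ : τ ≤ P.weight p k) => P.flag p k.castSucc) j hτ le_rfl

theorem flagAt_le_flag_succ {τ : ℝ} {j : Fin (P.len p)} (hτ : P.weight p j < τ) :
    P.flagAt p τ ≤ P.flag p j.succ :=
  iSup₂_le fun _ hk => (P.flag_strictAnti p).antitone
    (Fin.succ_le_castSucc_iff.2 ((P.weight_strictMono p).lt_iff_lt.1 (hτ.trans_le hk)))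

theorem flagAt_le_comap {A : Module.End ℂ (E p.1)} (hA : ∀ j, ∀ v ∈ P.flag p j, A v ∈ P.flag p j)
    (τ : ℝ) : P.flagAt p τ ≤ (P.flagAt p τ).comap A :=
  iSup₂_le fun _ hj v hv => P.flag_le_flagAt p hj (hA _ v hv)

theorem exists_isDualFrame_weighted [∀ x, FiniteDimensional ℂ (E x)] (y : X) :
    ∃ (ι : Type) (_ : Fintype ι) (a : ι → ℝ) (b : ι → E y) (c : ι → Module.Dual ℂ (E y)),
      IsDualFrame b c ∧ ∀ i, 0 ≤ a i ∧ a i < 1 ∧ ∀ h : y ∈ D, b i ∈ P.flagAt ⟨y, h⟩ (a i) ∧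
        ∀ τ, a i < τ → P.flagAt ⟨y, h⟩ τ ≤ LinearMap.ker (c i) := by
  by_cases hy : y ∈ D
  · obtain ⟨ι, _, j, b, c, frame_bc, hbc⟩ := exists_isDualFrame_adapted
      (P.flag_strictAnti ⟨y, hy⟩).antitone (P.flag_zero _) (P.flag_last _)
    exact ⟨ι, inferInstance, fun i => P.weight _ (j i), b, c, frame_bc, fun i =>
      ⟨P.weight_nonneg _ _, P.weight_lt_one _ _, fun _ => ⟨P.flag_le_flagAt _ le_rfl (hbc i).1,
        fun τ hτ v hv => (hbc i).2 v (P.flagAt_le_flag_succ _ hτ hv)⟩⟩⟩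
  · exact ⟨_, inferInstance, fun _ => 0, _, _, isDualFrame_coord (Module.finBasis ℂ (E y)),
      fun _ => ⟨le_rfl, zero_lt_one, fun h => absurd h hy⟩⟩

end Flags

section Frames

variable {X : Type*} [TopologicalSpace X] [ChartedSpace ℂ X] {D : Finset X}
  {F : Type*} [NormedAddCommGroup F] [NormedSpace ℂ F]
  {E : X → Type*} [TopologicalSpace (TotalSpace F E)] [∀ x, TopologicalSpace (E x)]
  [FiberBundle F E] [∀ x, AddCommGroup (E x)] [∀ x, Module ℂ (E x)] [VectorBundle ℂ F E]
  [ContMDiffVectorBundle ω F E 𝓘(ℂ, ℂ)] {P : ParabolicStructure D E}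
  {e : Trivialization F (TotalSpace.proj : TotalSpace F E → X)} [MemTrivializationAtlas e]
  {N : Opens X} {y : X} {a : ℝ}

theorem transport_mem_filtered (hNe : ∀ x ∈ N, x ∈ e.baseSet) (hND : ∀ x ∈ N, x ∈ D → x = y)
    (ha₀ : 0 ≤ a) (ha₁ : a < 1) {v : E y} (hv : ∀ h : y ∈ D, v ∈ P.flagAt ⟨y, h⟩ a) :
    (fun x : Cpl D => transport e y x v) ∈ P.filtered F a N := by
  refine fun x hx => ⟨fun _ => (holAt_transport y v (hNe x hx)).germAt trivial, fun hxD => ?_⟩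
  obtain rfl := hND x hx hxD
  rw [Int.fract_eq_self.2 ⟨ha₀, ha₁⟩, Int.floor_eq_zero_iff.2 ⟨ha₀, ha₁⟩]
  exact (holAt_transport x v (hNe x hx)).germAt (by rw [transport_self (hNe x hx)]; exact hv hxD)

theorem comp_transport_mem_dual_filtered [IsManifold 𝓘(ℂ, ℂ) ω X] [FiniteDimensional ℂ (E y)]
    (hy : y ∈ e.baseSet) (hNe : ∀ x ∈ N, x ∈ e.baseSet) (hND : ∀ x ∈ N, x ∈ D → x = y)
    (ha₀ : 0 ≤ a) (ha₁ : a < 1) {c : Module.Dual ℂ (E y)}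
    (hc : ∀ h : y ∈ D, ∀ τ, a < τ → P.flagAt ⟨y, h⟩ τ ≤ LinearMap.ker c) :
    (fun x : Cpl D => c ∘ₗ transport e x y) ∈ dual (P.filtered F) (-a) N := by
  intro N' hN' t s hs x hx
  have hxe := hNe x (hN' hx)
  have map_germ {m : ℤ} {S : Submodule ℂ (E x)} (h : GermAt F x m S s) {S' : Submodule ℂ ℂ}
      (hS : S ≤ S'.comap (c ∘ₗ transport e x y)) :
      GermAt (E := Bundle.Trivial X ℂ) ℂ x m S' fun x => c (transport e x.1 y (s x)) :=
    h.map (A := fun x => c ∘ₗ transport e x y) (fun _ hg => hg.apply_transport c hy hxe) hS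
  refine ⟨fun hxD => map_germ ((hs x hx).1 hxD) le_top, fun hxD => ?_⟩
  obtain rfl := hND x (hN' hx) hxD
  have germ_s := (hs x hx).2 hxD
  rw [sub_zero, ← sub_eq_add_neg]
  rcases le_or_gt (Int.fract t) a with hta | hat
  · rw [ceil_sub_eq_floor ha₁ hta]
    exact map_germ germ_s le_top
  · rw [ceil_sub_eq_floor_add_one ha₀ hat]
    refine (map_germ germ_s fun v hv => ?_).add_one_of_bot hxD
    rw [Submodule.mem_comap, LinearMap.comp_apply, transport_self hxe]
    exact hc hxD _ hat hv

variable (P F)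

theorem hasLocalFrames_filtered [IsManifold 𝓘(ℂ, ℂ) ω X] [∀ x, FiniteDimensional ℂ (E x)] :
    HasLocalFrames (P.filtered F) := by
  classical
  intro y
  have : T1Space X := ChartedSpace.t1Space ℂ X
  obtain ⟨ι, _, a, b, c, frame_bc, hbc⟩ := P.exists_isDualFrame_weighted y
  let e := trivializationAt F E y
  have hy : y ∈ e.baseSet := mem_baseSet_trivializationAt F E y
  let N : Opens X := ⟨e.baseSet ∩ (↑(D.erase y) : Set X)ᶜ,
    e.open_baseSet.inter (D.erase y).finite_toSet.isClosed.isOpen_compl⟩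
  have hND (x) (hx : x ∈ N) (hxD : x ∈ D) : x = y := by
    by_contra hxy
    exact hx.2 (Finset.mem_erase.2 ⟨hxy, hxD⟩)
  refine ⟨N, ⟨hy, by simp⟩, ι, inferInstance, a, fun i x => transport e y x (b i),
    fun i x => c i ∘ₗ transport e x y, fun N' hN' i => ?_,
    fun x hx => frame_bc.transport hx.1 hy⟩
  obtain ⟨ha₀, ha₁, hflag⟩ := hbc i
  have hNe (x) (hx : x ∈ N') : x ∈ e.baseSet := (hN' hx).1
  have hND' (x) (hx : x ∈ N') := hND x (hN' hx)
  exact ⟨transport_mem_filtered hNe hND' ha₀ ha₁ fun h => (hflag h).1,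
    comp_transport_mem_dual_filtered hy hNe hND' ha₀ ha₁ fun h => (hflag h).2⟩

end Frames

end ParabolicStructure

section HiggsFields

variable {X : Type*} [TopologicalSpace X] [ChartedSpace ℂ X] {D : Finset X}
  {FE : Type*} [NormedAddCommGroup FE] [NormedSpace ℂ FE]
  {E : X → Type*} [∀ x, AddCommGroup (E x)] [∀ x, Module ℂ (E x)]
  [TopologicalSpace (TotalSpace FE E)] [∀ x, TopologicalSpace (E x)] [FiberBundle FE E]
  {P : ParabolicStructure D E}

theorem ParabolicStructure.comp_mem_filtered {U : Opens X} {A : ∀ x, Module.End ℂ (E x)}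
    (hA : ∀ y ∈ U, ∀ g : ∀ x, E x, HolAt FE g y → HolAt FE (fun x => A x (g x)) y)
    (hflag : ∀ p : D, p.1 ∈ U → ∀ j, ∀ v ∈ P.flag p j, A p.1 v ∈ P.flag p j) {t : ℝ}
    {s : ∀ x : Cpl D, E x.1} (hs : s ∈ P.filtered FE t U) :
    (fun x : Cpl D => A x.1 (s x)) ∈ P.filtered FE t U :=
  fun y hy => ⟨fun hyD => ((hs y hy).1 hyD).map (hA y hy) le_top,
    fun hyD => ((hs y hy).2 hyD).map (hA y hy) (P.flagAt_le_comap _ (hflag ⟨y, hyD⟩ hy) _)⟩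

theorem ParabolicStructure.isHom_smul_id [VectorBundle ℂ FE E] (a : ℂ) :
    IsHom (P.filtered FE) (P.filtered FE) fun _ => a • LinearMap.id :=
  fun _ _ _ hs => comp_mem_filtered (A := fun _ => a • LinearMap.id)
    (fun _ _ _ hg => hg.const_smul a) (fun _ _ _ _ hv => Submodule.smul_mem _ a hv) hs

theorem ParabolicStructure.IsAdP.mem_homSheaf {U : Opens X} {A : ∀ x, Module.End ℂ (E x)}
    (hA : P.IsAdP FE U A) :
    (fun x : Cpl D => A x.1) ∈ homSheaf (P.filtered FE) (P.filtered FE) 0 U := by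
  intro N hN a s hs
  rw [add_zero]
  exact comp_mem_filtered (fun y hy => hA.1 y (hN hy)) (fun p hp => hA.2.2 p (hN hp)) hs

section Compatible

variable {θ : ∀ x : Cpl D, Module.End ℂ (E x.1) ⊗[ℂ] Cotangent x.1}

theorem IsHiggsField.mem_tensor_homSheaf [IsManifold 𝓘(ℂ, ℂ) ω X]
    (hθ : IsHiggsField FE P θ) :
    θ ∈ tensor (homSheaf (P.filtered FE) (P.filtered FE)) (canonicalLog X D) 0 ⊤ := by
  intro y _
  obtain ⟨N, hyN, n, A, η, hAη, hsum⟩ := hθ y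
  exact ⟨N, hyN, le_top, n, 0, 0, fun k x => A k x.1, η,
    fun k => ⟨(add_zero _).ge, (hAη k).1.mem_homSheaf, (hAη k).2⟩, hsum⟩

variable [VectorBundle ℂ FE E] [ContMDiffVectorBundle ω FE E 𝓘(ℂ, ℂ)]
  {L : X → Type*} [∀ x, AddCommGroup (L x)] [∀ x, Module ℂ (L x)]
  {φ : ∀ x : Cpl D, E x.1 ⊗[ℂ] E x.1 →ₗ[ℂ] L x.1}

variable (FE φ θ) in
theorem isCompatible_iff_fibrewise :
    IsCompatible FE φ θ ↔ ∀ (x : Cpl D) (u v : E x.1),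
      pairLeft (φ x) (higgsApply (θ x) u) v + pairRight (φ x) u (higgsApply (θ x) v) = 0 := by
  refine ⟨fun h x u v => ?_, fun h U u v _ _ x _ => h x _ _⟩
  let e := trivializationAt FE E x.1
  have hx : x.1 ∈ e.baseSet := mem_baseSet_trivializationAt FE E x.1
  have := h ⟨e.baseSet, e.open_baseSet⟩ (fun y => transport e x.1 y u)
    (fun y => transport e x.1 y v) (fun y => holAt_transport x.1 u)
    (fun y => holAt_transport x.1 v) x hx
  rwa [transport_self hx, transport_self hx] at this

variable [IsManifold 𝓘(ℂ, ℂ) ω X] [∀ x, FiniteDimensional ℂ (E x)]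
  {FL : Type*} [NormedAddCommGroup FL] [NormedSpace ℂ FL]
  [TopologicalSpace (TotalSpace FL L)] [∀ x, TopologicalSpace (L x)] [FiberBundle FL L]
  [VectorBundle ℂ FL L] [ContMDiffVectorBundle ω FL L 𝓘(ℂ, ℂ)] {Q : ParabolicStructure D L}

theorem higgsTensor_mem_tensor (hL : ∀ x, Module.finrank ℂ (L x) = 1)
    (hφ : IsPerfect FE FL P Q φ)
    (hθ : θ ∈ tensor (homSheaf (P.filtered FE) (P.filtered FE)) (canonicalLog X D) 0 ⊤) :
    higgsTensor hφ hL θ ∈ tensor (tensor (tensor (P.filtered FE) (P.filtered FE))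
      (dual (Q.filtered FL))) (canonicalLog X D) 0 ⊤ :=
  have (x : X) : FiniteDimensional ℂ (L x) := Module.finite_of_finrank_eq_succ (hL x)
  (isHom_endEquiv (fun x => hL x.1) (P.hasLocalFrames_filtered FE) (Q.hasLocalFrames_filtered FL)
    hφ.isIso.isHom_symm).rTensor _ _ _ _ hθ

theorem isCompatible_iff_higgsTensor_mem_signedSquare (hL : ∀ x, Module.finrank ℂ (L x) = 1)
    (hφ : IsPerfect FE FL P Q φ) {δ : ℂ} (hδ : δ * δ = 1)
    (hφδ : ∀ x u v, φ x (u ⊗ₜ v) = -δ • φ x (v ⊗ₜ u))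
    (hθ : θ ∈ tensor (homSheaf (P.filtered FE) (P.filtered FE)) (canonicalLog X D) 0 ⊤) :
    IsCompatible FE φ θ ↔ higgsTensor hφ hL θ ∈
      tensor (tensor (signedSquare δ (P.filtered FE)) (dual (Q.filtered FL)))
        (canonicalLog X D) 0 ⊤ := by
  have exchange_iff (x : Cpl D) := forall_pairLeft_add_pairRight_eq_zero_iff (hL x.1)
    (e := LinearEquiv.ofBijective (hat (φ x)) (hφ.isIso.bijective x)) (fun _ => rfl) hδ (hφδ x)
    (θ x)
  rw [mem_tensor_tensor_signedSquare_iff ParabolicStructure.isHom_smul_id hδ,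
    isCompatible_iff_fibrewise, forall_congr' exchange_iff]
  exact ⟨fun h => ⟨higgsTensor_mem_tensor hL hφ hθ, fun x _ => h x⟩, fun h x => h.2 x trivial⟩

theorem mainTheorem5_general (hL : ∀ x, Module.finrank ℂ (L x) = 1)
    (hθ : θ ∈ tensor (homSheaf (P.filtered FE) (P.filtered FE)) (canonicalLog X D) 0 ⊤) :
    (∀ hφ : IsSymplectic FE FL P Q φ,
      (IsCompatible FE φ θ ↔
        higgsTensor hφ.toIsPerfect hL θ ∈
          tensor (tensor (sym2 (P.filtered FE)) (dual (Q.filtered FL)))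
            (canonicalLog X D) 0 ⊤)) ∧
    (∀ hφ : IsOrthogonal FE FL P Q φ,
      (IsCompatible FE φ θ ↔
        higgsTensor hφ.toIsPerfect hL θ ∈
          tensor (tensor (wedge2 (P.filtered FE)) (dual (Q.filtered FL)))
            (canonicalLog X D) 0 ⊤)) := by
  simp only [← signedSquare_one, ← signedSquare_neg_one]
  exact ⟨fun hφ => isCompatible_iff_higgsTensor_mem_signedSquare hL hφ.toIsPerfect (by norm_num)
      (fun x u v => by rw [neg_one_smul, hφ.antisymm]) hθ,
    fun hφ => isCompatible_iff_higgsTensor_mem_signedSquare hL hφ.toIsPerfect (by norm_num)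
      (fun x u v => by rw [neg_neg, one_smul, hφ.symm]) hθ⟩

end Compatible

end HiggsFields

end ParabolicHiggs

open ParabolicHiggs in
theorem mainTheorem5
    {X : Type*} [TopologicalSpace X] [T2Space X] [CompactSpace X] [ConnectedSpace X]
    [ChartedSpace ℂ X] [IsManifold 𝓘(ℂ, ℂ) ω X] (D : Finset X)
    -- a holomorphic vector bundle `E`
    {FE : Type*} [NormedAddCommGroup FE] [NormedSpace ℂ FE]
    {E : X → Type*} [∀ x, AddCommGroup (E x)] [∀ x, Module ℂ (E x)]
    [TopologicalSpace (TotalSpace FE E)] [∀ x, TopologicalSpace (E x)] [FiberBundle FE E]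
    [VectorBundle ℂ FE E] [ContMDiffVectorBundle ω FE E 𝓘(ℂ, ℂ)]
    [∀ x, FiniteDimensional ℂ (E x)]
    -- a holomorphic line bundle `L`
    {FL : Type*} [NormedAddCommGroup FL] [NormedSpace ℂ FL]
    {L : X → Type*} [∀ x, AddCommGroup (L x)] [∀ x, Module ℂ (L x)]
    [TopologicalSpace (TotalSpace FL L)] [∀ x, TopologicalSpace (L x)] [FiberBundle FL L]
    [VectorBundle ℂ FL L] [ContMDiffVectorBundle ω FL L 𝓘(ℂ, ℂ)]
    (hL : ∀ x, Module.finrank ℂ (L x) = 1)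
    -- parabolic structures and a parabolic Higgs field
    (P : ParabolicStructure D E) (Q : ParabolicStructure D L)
    (θ : ∀ x : Cpl D, Module.End ℂ (E x.1) ⊗[ℂ] Cotangent x.1)
    (hθ : IsHiggsField FE P θ)
    (φ : ∀ x : Cpl D, E x.1 ⊗[ℂ] E x.1 →ₗ[ℂ] L x.1) :
    (∀ hφ : IsSymplectic FE FL P Q φ,
      (IsCompatible FE φ θ ↔
        higgsTensor hφ.toIsPerfect hL θ ∈
          tensor (tensor (sym2 (P.filtered FE)) (dual (Q.filtered FL)))
            (canonicalLog X D) 0 ⊤)) ∧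
    (∀ hφ : IsOrthogonal FE FL P Q φ,
      (IsCompatible FE φ θ ↔
        higgsTensor hφ.toIsPerfect hL θ ∈
          tensor (tensor (wedge2 (P.filtered FE)) (dual (Q.filtered FL)))
            (canonicalLog X D) 0 ⊤)) := by
  exact mainTheorem5_general hL hθ.mem_tensor_homSheaf
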